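/- A topological space $X$ is called $n$-strongly arc connected ($n$-sac) if for all distinct points $x_1,\dots,x_n\in X$ there are an arc $\alpha:[0,1]\to X$ (a homeomorphic embedding) and parameters $t_1<t_2<\dots<t_n$ in $[0,1]$ such that $\alpha(t_i)=x_i$ for $i=1,\dots,n$. Let $N\ge 3$ and let $v_1,\dots,v_N$ be affinely independent points of $\mathbb{R}^{N-1}$. Write $\langle w_1,\dots,w_N\rangle$ for the simplex (convex hull) with vertices $w_1,\dots,w_N$, and $w_i\wedge w_j$ for the midpoint of $w_i$ and $w_j$. Let $\mathrm{Trix}$ be the operation taking a simplex $\langle w_1,\dots,w_N\rangle$ to the set of the $N$ simplices $\langle w_i,\ w_i\wedge w_j : j\ne i\rangle$, $i=1,\dots,N$. Put $\mathcal{T}_0=\{\langle v_1,\dots,v_N\rangle\}$ and $\mathcal{T}_{m+1}=\bigcup_{S\in\mathcal{T}_m}\mathrm{Trix}(S)$ for $m\ge 0$. The $N$-trix with vertices $v_1,\dots,v_N$ is the subspace $\bigcap_{m\ge 0}\bigcup_{S\in\mathcal{T}_m}S$ of $\mathbb{R}^{N-1}$. **Lemma.** Let $n\ge 3$ and $N=6n^2+12n+1$.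 Then the $N$-trix (for any choice of affinely independent vertices $v_1,\dots,v_N\in\mathbb{R}^{N-1}$) is $n$-sac. -/

import Mathlib

/-- A topological space `X` is `n`-strongly arc connected (`n`-sac) if for all distinct points
`x₁, …, xₙ` there are an arc `α : [0,1] → X` (a homeomorphic embedding of the unit interval) and
parameters `t₁ < ⋯ < tₙ` in `[0,1]` with `α tᵢ = xᵢ` for all `i`. -/
def IsStronglyArcConnected (n : ℕ) (X : Type*) [TopologicalSpace X] : Prop :=
  ∀ x : Fin n → X, Function.Injective x →
    ∃ α : unitInterval → X, Topology.IsEmbedding α ∧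
      ∃ t : Fin n → unitInterval, StrictMono t ∧ ∀ i, α (t i) = x i

namespace NTrix

variable {N : ℕ} {E : Type*} [AddCommGroup E] [Module ℝ E]

/-- A simplex is given by its family of vertices `v`. The vertices of the `i`-th simplex
`⟨vᵢ, vᵢ ∧ vⱼ : j ≠ i⟩` of `Trix ⟨v₁, …, v_N⟩`, where `vᵢ ∧ vⱼ` is the midpoint of `vᵢ` and `vⱼ`;
for `j = i` the midpoint is `vᵢ` itself. -/
noncomputable def child (v : Fin N → E) (i : Fin N) : Fin N → E :=
  fun j => midpoint ℝ (v i) (v j)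

/-- The operation `Trix`, taking a simplex to the set of its `N` corner simplices. -/
def subdivide (v : Fin N → E) : Set (Fin N → E) :=
  {w | ∃ i, w = child v i}

/-- The set of simplices obtained from `⟨v₁, …, v_N⟩` after `m` applications of `Trix`. -/
def simplices (v : Fin N → E) : ℕ → Set (Fin N → E)
  | 0 => {v}
  | m + 1 => ⋃ S ∈ simplices v m, subdivide S

/-- The union of all simplices of level `m`. -/
def stage (v : Fin N → E) (m : ℕ) : Set E :=
  ⋃ S ∈ simplices v m, convexHull ℝ (Set.range S)

/-- The `N`-trix with vertices `v₁, …, v_N`: the intersection of all the stages. -/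
def trix (v : Fin N → E) : Set E :=
  ⋂ m : ℕ, stage v m

end NTrix

/-!
The points of an `N`-trix are described by addresses `a : ℕ → Fin N`, the choices of a corner
simplex made one after the other. The point with address `a` has the barycentric coordinates
`∑ m, if a m = i then 2^{-(m+1)} else 0`, so all work is done in barycentric coordinates
(`addressPoint`); affine independence of the vertices is used only to come back to the trix.

A point `x` with address `a` is joined to each vertex `j` by a ray (`ray`), which runs through the
vertices with number `j` of the cells containing `x`. On this ray all coordinates but the one with
number `j` increase towards `x`. Hence coordinate `j` tells its points apart and is a parameter
for it (`exists_param_raySet`). Comparing coordinates also shows that an address of a point of the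
ray other than `x` deviates from `a`, where it first does so, by the digit `j`
(`apply_firstDiff_eq_of_ray_eq`). So if `j ≠ k` are not among the digits by which the addresses of
two given points first deviate from each other, then the ray in direction `j` to the one point and
the ray in direction `k` to the other point are disjoint, and the rays in directions `j` and `k`
to the same point meet only there (`eq_of_mem_raySet_of_mem_raySet`).

The addresses of `n` given points deviate from each other by at most `n ^ 2` digits. If
`N ≥ n ^ 2 + n`, there are `n` further digits `c₁, …, cₙ`. The rays from the vertex `cᵢ` to the
`i`-th and to the next point have this vertex in common, so together they contain an arc between
the two points (`exists_arc_in_raySet`). By the choice of the directions these arcs meet only in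
the given points, as consecutive ones have to, and so make up one arc through all the points in
the given order (`exists_arc_through_addressPoints`). The number `6 n ^ 2 + 12 n + 1` of vertices is
more than enough.
-/

open Set Filter Topology

namespace NTrix

/-! ### Digit weights -/

/-- The weight `2^{-(m+1)}` of the `m`-th binary digit. -/
noncomputable def digitWeight (m : ℕ) : ℝ := (1 / 2) ^ (m + 1)

/-- The part of the `m`-th digit weight that is filled at time `s` when the digits are filled one
after the other at unit speed: the length of `[0, s] ∩ [1 - 2^{-m}, 1 - 2^{-(m+1)}]` for
`0 ≤ s`. -/
noncomputable def ramp (s : ℝ) (m : ℕ) : ℝ :=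
  min s (1 - (1 / 2) ^ (m + 1)) - min s (1 - (1 / 2) ^ m)

lemma half_pow_succ_le (m : ℕ) : (1 / 2 : ℝ) ^ (m + 1) ≤ (1 / 2) ^ m :=
  pow_le_pow_of_le_one (by norm_num) (by norm_num) (Nat.le_succ m)

lemma digitWeight_pos (m : ℕ) : 0 < digitWeight m := by
  unfold digitWeight; positivity

lemma hasSum_digitWeight : HasSum digitWeight 1 := by
  have h := hasSum_geometric_two.mul_left (1 / 2 : ℝ)
  rw [show (1 / 2 : ℝ) * 2 = 1 by norm_num] at h
  simp only [← pow_succ'] at h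
  exact h

lemma digitWeight_succ (m : ℕ) : digitWeight (m + 1) = digitWeight m / 2 := by
  unfold digitWeight; ring

/-- The digits after the `r`-th one weigh as much together as the `r`-th one alone. -/
lemma hasSum_digitWeight_tail (r : ℕ) :
    HasSum (fun m => digitWeight (m + (r + 1))) (digitWeight r) := by
  have h := hasSum_digitWeight.mul_left (digitWeight r)
  rw [mul_one] at h
  have e (m : ℕ) : digitWeight (m + (r + 1)) = digitWeight r * digitWeight m := by
    unfold digitWeight; ring
  simpa only [e] using h

lemma ramp_nonneg (s : ℝ) (m : ℕ) : 0 ≤ ramp s m := by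
  have := half_pow_succ_le m
  unfold ramp
  rw [sub_nonneg]
  exact min_le_min_left _ (by linarith)

lemma ramp_le (s : ℝ) (m : ℕ) : ramp s m ≤ digitWeight m := by
  have h : (1 / 2 : ℝ) ^ m = 2 * (1 / 2) ^ (m + 1) := by ring
  have h0 : (0 : ℝ) < (1 / 2) ^ (m + 1) := by positivity
  unfold ramp digitWeight
  rcases le_total s (1 - (1 / 2) ^ m) with hs | hs
  · rw [min_eq_left hs]
    linarith [min_le_left s (1 - (1 / 2 : ℝ) ^ (m + 1))]
  · rw [min_eq_right hs]
    linarith [min_le_right s (1 - (1 / 2 : ℝ) ^ (m + 1))]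

lemma ramp_mono {s t : ℝ} (hst : s ≤ t) (m : ℕ) : ramp s m ≤ ramp t m := by
  have h := half_pow_succ_le m
  unfold ramp
  rcases le_total s (1 - (1 / 2) ^ m) with hs | hs
  · rw [min_eq_left hs, min_eq_left (by linarith), sub_self]
    exact ramp_nonneg t m
  · rw [min_eq_right hs, min_eq_right (hs.trans hst)]
    exact sub_le_sub_right (min_le_min_right _ hst) _

lemma summable_ramp (s : ℝ) : Summable (ramp s) :=
  Summable.of_nonneg_of_le (ramp_nonneg s) (ramp_le s) hasSum_digitWeight.summable

lemma hasSum_ramp {s : ℝ} (hs : s ∈ Icc (0 : ℝ) 1) : HasSum (ramp s) s := by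
  rw [hasSum_iff_tendsto_nat_of_nonneg (ramp_nonneg s)]
  have h1 : ∀ n, ∑ m ∈ Finset.range n, ramp s m = min s (1 - (1 / 2) ^ n) := by
    intro n
    have := Finset.sum_range_sub (fun m => min s (1 - (1 / 2 : ℝ) ^ m)) n
    simp only [pow_zero, sub_self, min_eq_right hs.1, sub_zero] at this
    exact this
  simp only [h1]
  have h2 : Tendsto (fun n : ℕ => (1 / 2 : ℝ) ^ n) atTop (𝓝 0) :=
    tendsto_pow_atTop_nhds_zero_of_lt_one (by norm_num) (by norm_num)
  have h3 := (tendsto_const_nhds (x := s)).min ((tendsto_const_nhds (x := (1 : ℝ))).sub h2)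
  rwa [sub_zero, min_eq_left hs.2] at h3

lemma ramp_one (m : ℕ) : ramp 1 m = digitWeight m := by
  unfold ramp digitWeight
  rw [min_eq_right, min_eq_right]
  · ring
  · linarith [show (0 : ℝ) ≤ (1 / 2) ^ m by positivity]
  · linarith [show (0 : ℝ) ≤ (1 / 2) ^ (m + 1) by positivity]

lemma ramp_zero (m : ℕ) : ramp 0 m = 0 := by
  have h (k : ℕ) : (0 : ℝ) ≤ 1 - (1 / 2) ^ k :=
    sub_nonneg.2 (pow_le_one₀ (by norm_num) (by norm_num))
  unfold ramp
  rw [min_eq_left (h _), min_eq_left (h _), sub_self]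

lemma ramp_at_zero {s : ℝ} (hs : 0 ≤ s) : ramp s 0 = min s (1 / 2) := by
  unfold ramp
  norm_num [hs]

lemma ramp_succ {s : ℝ} (m : ℕ) : ramp s (m + 1) = ramp (2 * s - 1) m / 2 := by
  have h (k : ℕ) : min s (1 - (1 / 2) ^ (k + 1)) =
      1 / 2 + min (2 * s - 1) (1 - (1 / 2) ^ k) / 2 := by
    rw [pow_succ]
    rcases le_total (2 * s - 1) (1 - (1 / 2) ^ k) with hs | hs
    · rw [min_eq_left hs, min_eq_left (by linarith)]; ring
    · rw [min_eq_right hs, min_eq_right (by linarith)]; ring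
  unfold ramp
  rw [h, h]; ring

lemma ramp_eq_zero_of_nonpos {s : ℝ} (hs : s ≤ 0) (m : ℕ) : ramp s m = 0 :=
  le_antisymm ((ramp_mono hs m).trans (ramp_zero m).le) (ramp_nonneg s m)

/-- Before time `1` the digits after any given one are not all filled. -/
lemma tsum_ramp_tail_lt {s : ℝ} (hs : s < 1) (r : ℕ) :
    ∑' m, ramp s (m + (r + 1)) < digitWeight r := by
  obtain ⟨k, hk⟩ := exists_pow_lt_of_lt_one (sub_pos.2 hs) (show (1 / 2 : ℝ) < 1 by norm_num)
  rw [← (hasSum_digitWeight_tail r).tsum_eq]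
  refine Summable.tsum_lt_tsum (i := k) (fun m => ramp_le _ _) ?_
    ((summable_nat_add_iff _).2 (summable_ramp s)) (hasSum_digitWeight_tail r).summable
  have h1 : (1 / 2 : ℝ) ^ (k + (r + 1)) ≤ (1 / 2) ^ k :=
    pow_le_pow_of_le_one (by norm_num) (by norm_num) (by omega)
  have h2 := half_pow_succ_le (k + (r + 1))
  have : ramp s (k + (r + 1)) = 0 := by
    unfold ramp
    rw [min_eq_left (by linarith), min_eq_left (by linarith), sub_self]
  rw [this]
  exact digitWeight_pos _

lemma continuous_ramp (m : ℕ) : Continuous fun s => ramp s m := by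
  unfold ramp; fun_prop

/-! ### Addresses in barycentric coordinates -/

variable {N : ℕ}

/-- The barycentric coordinates that arise when the weight `w m` is given to the vertex `a m`. -/
noncomputable def digitMass (w : ℕ → ℝ) (a : ℕ → Fin N) : Fin N → ℝ :=
  fun i => ∑' m, if a m = i then w m else 0

/-- The barycentric coordinates of the point with address `a`: the one common to the cells that
are reached by choosing the corner simplices `a 0, a 1, …` one after the other. -/
noncomputable def addressPoint (a : ℕ → Fin N) : Fin N → ℝ := digitMass digitWeight a

/-- The path, in barycentric coordinates, from the vertex `j` at time `0` to the point with
address `a` at time `1`. It runs through the vertices with number `j` of the cells containing that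
point: between the times `1 - 2^{-m}` and `1 - 2^{-(m+1)}` the weight `2^{-(m+1)}` moves from the
vertex `j` to the vertex `a m`. -/
noncomputable def ray (j : Fin N) (a : ℕ → Fin N) (s : ℝ) : Fin N → ℝ :=
  fun i => (if i = j then 1 - s else 0) + digitMass (ramp s) a i

lemma summable_ite {w : ℕ → ℝ} (hw : Summable w) (a : ℕ → Fin N) (i : Fin N) :
    Summable fun m => if a m = i then w m else 0 := by
  refine (hw.indicator {m | a m = i}).congr fun m => ?_
  by_cases h : a m = i <;> simp [h]

lemma digitMass_nonneg {w : ℕ → ℝ} (hw : ∀ m, 0 ≤ w m) (a : ℕ → Fin N) (i : Fin N) :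
    0 ≤ digitMass w a i :=
  tsum_nonneg fun m => by split_ifs <;> simp [hw]

lemma sum_digitMass {w : ℕ → ℝ} {c : ℝ} (hw : HasSum w c) (a : ℕ → Fin N) :
    ∑ i, digitMass w a i = c := by
  unfold digitMass
  rw [← Summable.tsum_finsetSum fun i _ => summable_ite hw.summable a i, ← hw.tsum_eq]
  simp

lemma digitMass_succ {w : ℕ → ℝ} (hw : Summable w) (a : ℕ → Fin N) (i : Fin N) :
    digitMass w a i = (if a 0 = i then w 0 else 0) +
      digitMass (fun m => w (m + 1)) (fun m => a (m + 1)) i :=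
  (summable_ite hw a i).tsum_eq_zero_add

lemma digitMass_div_two (w : ℕ → ℝ) (a : ℕ → Fin N) (i : Fin N) :
    digitMass (fun m => w m / 2) a i = digitMass w a i / 2 := by
  unfold digitMass
  rw [← tsum_div_const]
  congr 1; ext m; split_ifs <;> simp

lemma addressPoint_nonneg (a : ℕ → Fin N) (i : Fin N) : 0 ≤ addressPoint a i :=
  digitMass_nonneg (fun m => (digitWeight_pos m).le) a i

lemma sum_addressPoint (a : ℕ → Fin N) : ∑ i, addressPoint a i = 1 :=
  sum_digitMass hasSum_digitWeight a

lemma addressPoint_le_one (a : ℕ → Fin N) (j : Fin N) : addressPoint a j ≤ 1 := by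
  rw [← sum_addressPoint a]
  exact Finset.single_le_sum (fun i _ => addressPoint_nonneg a i) (Finset.mem_univ j)

lemma addressPoint_succ (a : ℕ → Fin N) (i : Fin N) :
    addressPoint a i = ((if a 0 = i then 1 else 0) + addressPoint (fun m => a (m + 1)) i) / 2 := by
  unfold addressPoint
  rw [digitMass_succ hasSum_digitWeight.summable]
  simp only [digitWeight_succ, digitMass_div_two]
  have : digitWeight 0 = 1 / 2 := by norm_num [digitWeight]
  rw [this]
  split_ifs <;> ring

lemma continuous_addressPoint : Continuous (addressPoint : (ℕ → Fin N) → Fin N → ℝ) := by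
  refine continuous_pi fun i => ?_
  refine continuous_tsum (u := digitWeight) (fun m => ?_) hasSum_digitWeight.summable ?_
  · exact (continuous_of_discreteTopology (f := fun k : Fin N =>
      if k = i then digitWeight m else 0)).comp (continuous_apply m)
  · intro m a
    have := (digitWeight_pos m).le
    split_ifs <;> simp [abs_of_nonneg, this]

lemma isCompact_range_addressPoint :
    IsCompact (range (addressPoint : (ℕ → Fin N) → Fin N → ℝ)) :=
  isCompact_range continuous_addressPoint

/-! ### Rays -/

lemma ray_nonneg (j : Fin N) (a : ℕ → Fin N) {s : ℝ} (hs : s ∈ Icc (0 : ℝ) 1) (i : Fin N) :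
    0 ≤ ray j a s i := by
  have := digitMass_nonneg (ramp_nonneg s) a i
  have := hs.2
  unfold ray
  split_ifs <;> linarith

lemma sum_ray (j : Fin N) (a : ℕ → Fin N) {s : ℝ} (hs : s ∈ Icc (0 : ℝ) 1) :
    ∑ i, ray j a s i = 1 := by
  unfold ray
  rw [Finset.sum_add_distrib, sum_digitMass (hasSum_ramp hs)]
  simp

lemma ray_one (j : Fin N) (a : ℕ → Fin N) : ray j a 1 = addressPoint a := by
  ext i
  simp [ray, addressPoint, show ramp 1 = digitWeight from funext ramp_one]

lemma ray_zero (j : Fin N) (a : ℕ → Fin N) (i : Fin N) : ray j a 0 i = if i = j then 1 else 0 := by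
  simp [ray, digitMass, ramp_zero]

lemma continuous_ray (j : Fin N) (a : ℕ → Fin N) : Continuous (ray j a) := by
  refine continuous_pi fun i => Continuous.add ?_ ?_
  · split_ifs <;> fun_prop
  · refine continuous_tsum (u := digitWeight) (fun m => ?_) hasSum_digitWeight.summable ?_
    · split_ifs
      · exact continuous_ramp m
      · fun_prop
    · intro m s
      have := (digitWeight_pos m).le
      split_ifs <;> simp [abs_of_nonneg, this, ramp_nonneg, ramp_le]

/-- A point of a ray is the midpoint of a vertex and a point of another ray: the first half of the
ray runs along an edge of the simplex, inside the cell `j`, and the second half is a ray of the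
cell `a 0`. -/
lemma exists_ray_eq_midpoint (j : Fin N) (a : ℕ → Fin N) {s : ℝ} (hs : s ∈ Icc (0 : ℝ) 1) :
    ∃ (k : Fin N) (a' : ℕ → Fin N), ∃ s' ∈ Icc (0 : ℝ) 1,
      ∀ i, ray j a s i = ((if k = i then 1 else 0) + ray j a' s' i) / 2 := by
  have key (t : ℝ) (i : Fin N) : digitMass (ramp t) a i = (if a 0 = i then ramp t 0 else 0) +
      digitMass (ramp (2 * t - 1)) (fun m => a (m + 1)) i / 2 := by
    rw [digitMass_succ (summable_ramp t)]
    simp only [ramp_succ, digitMass_div_two]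
  rcases le_total s (1 / 2) with h | h
  · refine ⟨j, fun _ => a 0, 2 * s, ⟨by linarith [hs.1], by linarith⟩, fun i => ?_⟩
    have h0 : digitMass (ramp (2 * s - 1)) (fun m => a (m + 1)) i = 0 := by
      simp [digitMass, ramp_eq_zero_of_nonpos (show 2 * s - 1 ≤ 0 by linarith)]
    have h1 : digitMass (ramp (2 * s)) (fun _ => a 0) i = if a 0 = i then 2 * s else 0 := by
      unfold digitMass
      split_ifs
      · exact (hasSum_ramp ⟨by linarith [hs.1], by linarith⟩).tsum_eq
      · simp
    unfold ray
    rw [key, h0, h1, ramp_at_zero hs.1, min_eq_left h]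
    simp only [eq_comm (a := j)]
    split_ifs <;> ring
  · refine ⟨a 0, fun m => a (m + 1), 2 * s - 1, ⟨by linarith, by linarith [hs.2]⟩, fun i => ?_⟩
    unfold ray
    rw [key, ramp_at_zero hs.1, min_eq_right h]
    split_ifs <;> ring

/-- The vertices that come up when midpoints are taken `m` times are the first `m` digits of an
address. -/
lemma exists_addressPoint_near_ray (j : Fin N) (m : ℕ) (a : ℕ → Fin N) {s : ℝ}
    (hs : s ∈ Icc (0 : ℝ) 1) :
    ∃ b : ℕ → Fin N, ∀ i, |ray j a s i - addressPoint b i| ≤ (1 / 2) ^ m := by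
  induction m generalizing a s with
  | zero =>
    refine ⟨a, fun i => ?_⟩
    have h1 := ray_nonneg j a hs
    have h2 := Finset.single_le_sum (fun k _ => h1 k) (Finset.mem_univ i)
    rw [sum_ray j a hs] at h2
    rw [pow_zero, abs_le]
    constructor <;> linarith [h1 i, addressPoint_nonneg a i, addressPoint_le_one a i]
  | succ m ih =>
    obtain ⟨k, a', s', hs', h⟩ := exists_ray_eq_midpoint j a hs
    obtain ⟨b, hb⟩ := ih a' hs'
    refine ⟨fun m => Nat.casesOn m k b, fun i => ?_⟩
    rw [h, addressPoint_succ]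
    change |_ - ((if k = i then 1 else 0) + addressPoint b i) / 2| ≤ _
    have := hb i
    rw [abs_le] at this ⊢
    rw [pow_succ]
    constructor <;> linarith

/-- Rays run within the gasket. -/
lemma ray_mem_range (j : Fin N) (a : ℕ → Fin N) {s : ℝ} (hs : s ∈ Icc (0 : ℝ) 1) :
    ray j a s ∈ range (addressPoint : (ℕ → Fin N) → Fin N → ℝ) := by
  rw [← isCompact_range_addressPoint.isClosed.closure_eq, Metric.mem_closure_iff]
  intro ε hε
  obtain ⟨m, hm⟩ := exists_pow_lt_of_lt_one hε (show (1 / 2 : ℝ) < 1 by norm_num)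
  obtain ⟨b, hb⟩ := exists_addressPoint_near_ray j m a hs
  refine ⟨_, mem_range_self b, lt_of_le_of_lt ?_ hm⟩
  rw [dist_pi_le_iff (by positivity)]
  exact hb

/-- The combinatorial heart of the argument: an address of a point of the ray from the vertex `j`
to the point with address `a` deviates from `a` by the digit `j`. -/
lemma apply_firstDiff_eq_of_ray_eq {j : Fin N} {a b : ℕ → Fin N} {s : ℝ} (hs : s < 1)
    (h : ray j a s = addressPoint b) (hab : a ≠ b) : b (PiNat.firstDiff a b) = j := by
  by_contra hne
  have har := PiNat.apply_firstDiff_ne hab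
  have hlt : ∀ m < PiNat.firstDiff a b, a m = b m := fun m => PiNat.apply_eq_of_lt_firstDiff
  generalize PiNat.firstDiff a b = r at hne har hlt
  have hi := congrFun h (b r)
  simp only [ray, if_neg hne, zero_add, addressPoint, digitMass] at hi
  -- Coordinate `b r` of the right side is at least the digits before `r` plus digit `r`; on the
  -- left side digit `r` is missing and the later ones are not all filled.
  have h1 : ∑ m ∈ Finset.range r, (if b m = b r then digitWeight m else 0) + digitWeight r ≤
      ∑' m, if b m = b r then digitWeight m else 0 := by
    have := (summable_ite hasSum_digitWeight.summable b (b r)).sum_le_tsum (Finset.range (r + 1))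
      (fun m _ => by split_ifs <;> simp [(digitWeight_pos m).le])
    rw [Finset.sum_range_succ] at this
    simpa using this
  have h2 := (summable_ite (summable_ramp s) a (b r)).sum_add_tsum_nat_add (r + 1)
  rw [Finset.sum_range_succ, if_neg har, add_zero] at h2
  have h3 : ∑ m ∈ Finset.range r, (if a m = b r then ramp s m else 0) ≤
      ∑ m ∈ Finset.range r, (if b m = b r then digitWeight m else 0) := by
    refine Finset.sum_le_sum fun m hm => ?_
    rw [hlt m (Finset.mem_range.1 hm)]
    split_ifs
    · exact ramp_le s m
    · exact le_rfl
  have h4 : ∑' m, (if a (m + (r + 1)) = b r then ramp s (m + (r + 1)) else 0) ≤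
      ∑' m, ramp s (m + (r + 1)) := by
    have hs := (summable_nat_add_iff (r + 1)).2 (summable_ramp s)
    refine Summable.tsum_le_tsum (fun m => ?_) (summable_ite hs (fun m => a (m + (r + 1))) (b r)) hs
    split_ifs
    · exact le_rfl
    · exact ramp_nonneg _ _
  linarith [tsum_ramp_tail_lt hs r]

/-- The points of the ray from the vertex `j` to the point with address `a`. -/
def raySet (j : Fin N) (a : ℕ → Fin N) : Set (Fin N → ℝ) := ray j a '' Icc 0 1

lemma firstDiff_eq {a b : ℕ → Fin N} {r : ℕ} (hlt : ∀ m < r, a m = b m) (hr : a r ≠ b r) :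
    PiNat.firstDiff a b = r := by
  have hab : a ≠ b := fun h => hr (congrFun h r)
  rcases lt_trichotomy (PiNat.firstDiff a b) r with h | h | h
  · exact absurd (hlt _ h) (PiNat.apply_firstDiff_ne hab)
  · exact h
  · exact absurd (PiNat.apply_eq_of_lt_firstDiff h) hr

/-- Rays in different directions `j ≠ k` meet at most in a common end point inside the gasket,
provided that the directions avoid the digits by which the addresses deviate from each other. -/
lemma eq_of_mem_raySet_of_mem_raySet {j k : Fin N} {a a' : ℕ → Fin N} {z : Fin N → ℝ}
    (hz : z ∈ raySet j a) (hz' : z ∈ raySet k a') (hjk : j ≠ k)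
    (hj : a ≠ a' → a' (PiNat.firstDiff a a') ≠ j)
    (hk : a ≠ a' → a (PiNat.firstDiff a' a) ≠ k) :
    z = addressPoint a ∧ z = addressPoint a' := by
  obtain ⟨s, hs, hsz⟩ := hz
  obtain ⟨t, ht, htz⟩ := hz'
  rcases hs.2.eq_or_lt with rfl | hs1
  · have hza : z = addressPoint a := by rw [← hsz, ray_one]
    refine ⟨hza, ?_⟩
    rcases ht.2.eq_or_lt with rfl | ht1
    · rw [← htz, ray_one]
    · by_contra hne
      have haa : a ≠ a' := fun h => hne (h ▸ hza)
      exact hk haa (apply_firstDiff_eq_of_ray_eq ht1 (htz.trans hza) haa.symm)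
  obtain ⟨b, hb⟩ := ray_mem_range j a hs
  rw [hsz] at hb
  have key : z = addressPoint a → a = a' ∨ z = addressPoint a' := by
    intro hza
    by_contra! h
    rcases ht.2.eq_or_lt with rfl | ht1
    · exact h.2 (by rw [← htz, ray_one])
    · exact hk h.1 (apply_firstDiff_eq_of_ray_eq ht1 (htz.trans hza) h.1.symm)
  have key' : z = addressPoint a' → a = a' := by
    intro hza
    by_contra h
    exact hj h (apply_firstDiff_eq_of_ray_eq hs1 (hsz.trans hza) h)
  by_cases hza' : z = addressPoint a'
  · exact ⟨by rw [key' hza', hza'], hza'⟩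
  by_cases hza : z = addressPoint a
  · rcases key hza with h | h
    · exact ⟨hza, h ▸ hza⟩
    · exact ⟨hza, h⟩
  -- Now `b` differs from both `a` and `a'`, and its first deviations from them are `j` and `k`.
  exfalso
  have ht1 : t < 1 := ht.2.lt_of_ne fun h => hza' (by rw [← htz, h, ray_one])
  have hab : a ≠ b := fun h => hza (by rw [h, hb])
  have hab' : a' ≠ b := fun h => hza' (by rw [h, hb])
  have h1 := apply_firstDiff_eq_of_ray_eq hs1 (hsz.trans hb.symm) hab
  have h2 := apply_firstDiff_eq_of_ray_eq ht1 (htz.trans hb.symm) hab'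
  have hr := PiNat.apply_firstDiff_ne hab
  have hr' := PiNat.apply_firstDiff_ne hab'
  have hl : ∀ m < PiNat.firstDiff a b, a m = b m := fun m => PiNat.apply_eq_of_lt_firstDiff
  have hl' : ∀ m < PiNat.firstDiff a' b, a' m = b m := fun m => PiNat.apply_eq_of_lt_firstDiff
  generalize PiNat.firstDiff a b = r at *
  generalize PiNat.firstDiff a' b = r' at *
  rcases lt_trichotomy r r' with h | rfl | h
  · have hne : a r ≠ a' r := by rwa [hl' r h]
    refine hj (fun e => hne (congrFun e r)) ?_
    rw [firstDiff_eq (fun m hm => (hl m hm).trans (hl' m (hm.trans h)).symm) hne, hl' r h, h1]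
  · exact hjk (h1.symm.trans h2)
  · have hne : a' r' ≠ a r' := by rwa [hl r' h]
    refine hk (fun e => hne (congrFun e.symm r')) ?_
    rw [firstDiff_eq (fun m hm => (hl' m hm).trans (hl m (hm.trans h)).symm) hne, hl r' h, h2]

/-! ### Joining arcs -/

/-- A continuous real function that is injective on a compact set `K` has a continuous section over
every closed interval contained in its image. -/
lemma exists_continuous_section {X : Type*} [TopologicalSpace X] {K : Set X} (hK : IsCompact K)
    {f : X → ℝ} (hf : ContinuousOn f K) (hinj : InjOn f K) {p q : ℝ} (hpq : p ≤ q)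
    (hI : Icc p q ⊆ f '' K) :
    ∃ g : ℝ → X, Continuous g ∧ ∀ t ∈ Icc p q, g t ∈ K ∧ f (g t) = t := by
  choose g₀ hgK hgf using fun t : Icc p q => hI t.2
  have hg : Continuous g₀ := by
    rw [continuous_iff_isClosed]
    intro C hC
    have himg : IsCompact (f '' (K ∩ C)) :=
      (hK.inter_right hC).image_of_continuousOn (hf.mono inter_subset_left)
    convert himg.isClosed.preimage (continuous_subtype_val (p := (· ∈ Icc p q))) using 1
    ext t
    constructor
    · exact fun h => ⟨g₀ t, ⟨hgK t, h⟩, hgf t⟩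
    · rintro ⟨x, ⟨hxK, hxC⟩, hx⟩
      have : x = g₀ t := hinj hxK (hgK t) (hx.trans (hgf t).symm)
      rwa [mem_preimage, ← this]
  refine ⟨IccExtend hpq g₀, hg.Icc_extend', fun t ht => ?_⟩
  rw [IccExtend_of_mem hpq g₀ ht]
  exact ⟨hgK _, hgf _⟩

/-- Two arcs that are parametrized by the same real function `f`, and end at the same point, contain
an arc joining their initial points: follow the first arc up to its first meeting point
with the second one, and then the second arc backwards. -/
lemma exists_arc_of_common_end {X : Type*} [TopologicalSpace X] [T2Space X] {f : X → ℝ}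
    {g g' : ℝ → X} (hg : Continuous g) (hg' : Continuous g') {p p' q : ℝ} (hp : p ≤ q)
    (hp' : p' ≤ q) (hf : ∀ t ∈ Icc p q, f (g t) = t) (hf' : ∀ t ∈ Icc p' q, f (g' t) = t)
    (hq : g q = g' q) (hne : g p ≠ g' p') :
    ∃ γ : ℝ → X, Continuous γ ∧ InjOn γ (Icc 0 1) ∧ γ 0 = g p ∧ γ 1 = g' p' ∧
      ∀ u ∈ Icc (0 : ℝ) 1, γ u ∈ g '' Icc p q ∪ g' '' Icc p' q := by
  have hZ : IsCompact {t | t ∈ Icc (max p p') q ∧ g t = g' t} :=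
    isCompact_Icc.inter_right (isClosed_eq hg hg')
  obtain ⟨t₀, ⟨⟨ht₀, ht₀q⟩, htg⟩, hmin⟩ :=
    hZ.exists_isLeast ⟨q, ⟨max_le hp hp', le_rfl⟩, hq⟩
  have h1 : p ≤ t₀ := (le_max_left _ _).trans ht₀
  have h2 : p' ≤ t₀ := (le_max_right _ _).trans ht₀
  have hL : 0 < (t₀ - p) + (t₀ - p') := by
    refine lt_of_le_of_ne (by linarith) fun h => hne ?_
    rwa [show p = t₀ by linarith, show p' = t₀ by linarith]
  set L := (t₀ - p) + (t₀ - p') with hLdef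
  refine ⟨fun u => if p + L * u ≤ t₀ then g (p + L * u) else g' (2 * t₀ - (p + L * u)),
    ?_, ?_, ?_, ?_, ?_⟩
  · refine Continuous.if_le (by fun_prop) (by fun_prop) (by fun_prop) (by fun_prop) ?_
    intro u hu
    rw [hu, htg]; congr 1; ring
  · -- An equality between the two branches would be a meeting point before `t₀`.
    have hmix : ∀ u v : ℝ, 0 ≤ u → v ≤ 1 → p + L * u ≤ t₀ → t₀ < p + L * v →
        g (p + L * u) ≠ g' (2 * t₀ - (p + L * v)) := by
      intro u v hu hv hut hvt heq
      have hu' : 0 ≤ L * u := mul_nonneg hL.le hu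
      have hv' : L * v ≤ L := mul_le_of_le_one_right hL.le hv
      have e1 := hf (p + L * u) ⟨by linarith, by linarith⟩
      have e2 := hf' (2 * t₀ - (p + L * v)) ⟨by linarith, by linarith⟩
      have e : p + L * u = 2 * t₀ - (p + L * v) := by rw [← e1, heq, e2]
      have := hmin ⟨⟨max_le (by linarith) (by linarith), by linarith⟩, e ▸ heq⟩
      linarith
    intro u hu v hv huv
    have hu1 : 0 ≤ L * u := mul_nonneg hL.le hu.1
    have hu2 : L * u ≤ L := mul_le_of_le_one_right hL.le hu.2
    have hv1 : 0 ≤ L * v := mul_nonneg hL.le hv.1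
    have hv2 : L * v ≤ L := mul_le_of_le_one_right hL.le hv.2
    dsimp only at huv
    suffices L * u = L * v from mul_left_cancel₀ hL.ne' this
    split_ifs at huv with hu' hv' hv'
    · have := congrArg f huv
      rw [hf _ ⟨by linarith, by linarith⟩, hf _ ⟨by linarith, by linarith⟩] at this
      linarith
    · exact absurd huv (hmix u v hu.1 hv.2 hu' (not_le.1 hv'))
    · exact absurd huv.symm (hmix v u hv.1 hu.2 hv' (not_le.1 hu'))
    · have := congrArg f huv
      rw [hf' _ ⟨by linarith, by linarith⟩, hf' _ ⟨by linarith, by linarith⟩] at this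
      linarith
  · simp [h1]
  · dsimp only
    rw [mul_one]
    split_ifs with h
    · have e1 : p + L = t₀ := by linarith
      have e2 : p' = t₀ := by linarith
      rw [e1, e2, htg]
    · congr 1; linarith
  · intro u hu
    have hu1 : 0 ≤ L * u := mul_nonneg hL.le hu.1
    have hu2 : L * u ≤ L := mul_le_of_le_one_right hL.le hu.2
    dsimp only
    split_ifs with h
    · exact Or.inl ⟨_, ⟨by linarith, by linarith⟩, rfl⟩
    · exact Or.inr ⟨_, ⟨by linarith, by linarith⟩, rfl⟩

/-- A chain of arcs, of which only consecutive ones meet, and these only where the one ends and the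
other one begins, can be concatenated to one arc. -/
lemma exists_arc_of_chain {X : Type*} [TopologicalSpace X] (x : ℕ → X) (γ : ℕ → ℝ → X) (n : ℕ)
    (hγ : ∀ i < n, Continuous (γ i)) (hinj : ∀ i < n, InjOn (γ i) (Icc 0 1))
    (h0 : ∀ i < n, γ i 0 = x i) (h1 : ∀ i < n, γ i 1 = x (i + 1))
    (hdisj : ∀ i l, i < l → l < n → ∀ s ∈ Icc (0 : ℝ) 1, ∀ t ∈ Icc (0 : ℝ) 1, γ i s = γ l t →
      l = i + 1 ∧ γ i s = x l) :
    ∃ Γ : ℝ → X, Continuous Γ ∧ InjOn Γ (Icc 0 n) ∧ (∀ i ≤ n, Γ i = x i) ∧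
      ∀ u ∈ Icc (0 : ℝ) n, u = 0 ∨ ∃ i < n, ∃ s ∈ Ioc (0 : ℝ) 1, Γ u = γ i s := by
  induction n with
  | zero =>
    refine ⟨fun _ => x 0, continuous_const, ?_, ?_, ?_⟩
    · intro u hu v hv _
      simp only [Nat.cast_zero, Icc_self, mem_singleton_iff] at hu hv
      rw [hu, hv]
    · intro i hi
      rw [Nat.le_zero.1 hi]
    · intro u hu
      simp only [Nat.cast_zero, Icc_self, mem_singleton_iff] at hu
      exact Or.inl hu
  | succ n ih =>
    obtain ⟨Γ, hΓ, hΓi, hΓx, hΓγ⟩ := ih (fun i hi => hγ i (hi.trans n.lt_succ_self))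
      (fun i hi => hinj i (hi.trans n.lt_succ_self)) (fun i hi => h0 i (hi.trans n.lt_succ_self))
      (fun i hi => h1 i (hi.trans n.lt_succ_self))
      (fun i l hil hl => hdisj i l hil (hl.trans n.lt_succ_self))
    have hn := n.lt_succ_self
    -- The new arc does not meet the old part after its initial point.
    have hmix : ∀ u ∈ Icc (0 : ℝ) n, ∀ s ∈ Ioc (0 : ℝ) 1, Γ u ≠ γ n s := by
      intro u hu s hs heq
      have hx : γ n s = x n := by
        rcases hΓγ u hu with rfl | ⟨i, hi, t, ht, hut⟩
        · rcases Nat.eq_zero_or_pos n with rfl | hpos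
          · rw [← heq, ← hΓx 0 le_rfl, Nat.cast_zero]
          · have e : γ 0 0 = γ n s := by
              rw [h0 0 (by omega), ← heq, ← hΓx 0 (by omega), Nat.cast_zero]
            rw [← e]
            exact (hdisj 0 n hpos hn 0 ⟨le_rfl, zero_le_one⟩ s ⟨hs.1.le, hs.2⟩ e).2
        · rw [hut] at heq
          rw [← heq]
          exact (hdisj i n hi hn t ⟨ht.1.le, ht.2⟩ s ⟨hs.1.le, hs.2⟩ heq).2
      rw [← h0 n hn] at hx
      exact hs.1.ne' (hinj n hn ⟨hs.1.le, hs.2⟩ ⟨le_rfl, zero_le_one⟩ hx)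
    refine ⟨fun u => if u ≤ n then Γ u else γ n (u - n), ?_, ?_, ?_, ?_⟩
    · have := hγ n hn
      refine Continuous.if_le hΓ (by fun_prop) continuous_id continuous_const ?_
      rintro u rfl
      rw [sub_self, h0 n hn, hΓx n le_rfl]
    · intro u hu v hv huv
      rw [Nat.cast_succ] at hu hv
      dsimp only at huv
      split_ifs at huv with hu' hv' hv'
      · exact hΓi ⟨hu.1, hu'⟩ ⟨hv.1, hv'⟩ huv
      · exact absurd huv (hmix u ⟨hu.1, hu'⟩ _ ⟨by linarith, by linarith [hv.2]⟩)
      · exact absurd huv.symm (hmix v ⟨hv.1, hv'⟩ _ ⟨by linarith, by linarith [hu.2]⟩)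
      · have := hinj n hn ⟨by linarith, by linarith [hu.2]⟩ ⟨by linarith, by linarith [hv.2]⟩ huv
        linarith
    · intro i hi
      rcases Nat.le_succ_iff.1 hi with h | rfl
      · simp [h, hΓx i h]
      · simp [h1 n hn]
    · intro u hu
      rw [Nat.cast_succ] at hu
      dsimp only
      split_ifs with h
      · rcases hΓγ u ⟨hu.1, h⟩ with h' | ⟨i, hi, h'⟩
        · exact Or.inl h'
        · exact Or.inr ⟨i, hi.trans hn, h'⟩
      · exact Or.inr ⟨n, hn, u - n, ⟨by linarith, by linarith [hu.2]⟩, rfl⟩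

/-! ### Arcs in the gasket -/

/-- Along a ray from the vertex `j` all other coordinates increase, so the coordinate `j` tells its
points apart. -/
lemma injOn_raySet (j : Fin N) (a : ℕ → Fin N) : InjOn (fun z => z j) (raySet j a) := by
  have key : ∀ s ∈ Icc (0 : ℝ) 1, ∀ t ∈ Icc (0 : ℝ) 1, s ≤ t → ray j a s j = ray j a t j →
      ray j a s = ray j a t := by
    intro s hs t ht hst h
    have hle : ∀ i ∈ Finset.univ, ray j a s i ≤ ray j a t i := by
      intro i _
      by_cases hij : i = j
      · rw [hij, h]
      · simp only [ray, if_neg hij, zero_add]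
        refine Summable.tsum_le_tsum (fun m => ?_) (summable_ite (summable_ramp s) a i)
          (summable_ite (summable_ramp t) a i)
        split_ifs
        · exact ramp_mono hst m
        · exact le_rfl
    have := (Finset.sum_eq_sum_iff_of_le hle).1 (by rw [sum_ray j a hs, sum_ray j a ht])
    exact funext fun i => this i (Finset.mem_univ i)
  rintro _ ⟨s, hs, rfl⟩ _ ⟨t, ht, rfl⟩ h
  rcases le_total s t with hst | hst
  · exact key s hs t ht hst h
  · exact (key t ht s hs hst h.symm).symm

/-- The ray from the vertex `j` to the point with address `a` is an arc (or a point), with the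
coordinate `j` as its parameter. -/
lemma exists_param_raySet (j : Fin N) (a : ℕ → Fin N) :
    ∃ g : ℝ → Fin N → ℝ, Continuous g ∧ g (addressPoint a j) = addressPoint a ∧
      g 1 = (fun i => if i = j then 1 else 0) ∧
      ∀ t ∈ Icc (addressPoint a j) 1, g t ∈ raySet j a ∧ g t j = t := by
  have h1 := addressPoint_le_one a j
  have hcont : Continuous fun s => ray j a s j := (continuous_apply j).comp (continuous_ray j a)
  obtain ⟨g, hg, hgt⟩ := exists_continuous_section
    (isCompact_Icc.image (continuous_ray j a)) (continuous_apply j).continuousOn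
    (injOn_raySet j a) h1 (by
      have h := intermediate_value_Icc' zero_le_one hcont.continuousOn
      simp only [ray_one, ray_zero, if_true] at h
      rwa [image_image])
  have hend {t : ℝ} (ht : t ∈ Icc (addressPoint a j) 1) {z : Fin N → ℝ} (hz : z ∈ raySet j a)
      (hzt : z j = t) : g t = z :=
    injOn_raySet j a (hgt t ht).1 hz ((hgt t ht).2.trans hzt.symm)
  refine ⟨g, hg, ?_, ?_, hgt⟩
  · exact hend ⟨le_rfl, h1⟩ ⟨1, by simp, ray_one j a⟩ rfl
  · exact hend ⟨h1, le_rfl⟩ ⟨0, by simp, funext (ray_zero j a)⟩ (by simp)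

/-- Any two points of the gasket are joined by an arc within their rays to any given vertex. -/
lemma exists_arc_in_raySet (j : Fin N) {a a' : ℕ → Fin N}
    (hne : addressPoint a ≠ addressPoint a') :
    ∃ γ : ℝ → Fin N → ℝ, Continuous γ ∧ InjOn γ (Icc 0 1) ∧ γ 0 = addressPoint a ∧
      γ 1 = addressPoint a' ∧ ∀ u ∈ Icc (0 : ℝ) 1, γ u ∈ raySet j a ∪ raySet j a' := by
  obtain ⟨g, hg, hga, hg1, hgt⟩ := exists_param_raySet j a
  obtain ⟨g', hg', hga', hg1', hgt'⟩ := exists_param_raySet j a'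
  obtain ⟨γ, hγ, hinj, h0, h1, hmem⟩ := exists_arc_of_common_end (f := fun z => z j) hg hg'
    (addressPoint_le_one a j) (addressPoint_le_one a' j) (fun t ht => (hgt t ht).2)
    (fun t ht => (hgt' t ht).2) (hg1.trans hg1'.symm) (by rwa [hga, hga'])
  refine ⟨γ, hγ, hinj, h0.trans hga, h1.trans hga', fun u hu => ?_⟩
  rcases hmem u hu with ⟨t, ht, h⟩ | ⟨t, ht, h⟩
  · exact Or.inl (h ▸ (hgt t ht).1)
  · exact Or.inr (h ▸ (hgt' t ht).1)

/-- Directions that avoid finitely many forbidden ones. The forbidden ones are the at most `n ^ 2`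
digits by which the given addresses deviate from each other. -/
lemma exists_directions {n : ℕ} (hN : n ^ 2 + n ≤ N) (a : Fin n → ℕ → Fin N) :
    ∃ c : Fin n → Fin N, Function.Injective c ∧
      ∀ i k l, a k (PiNat.firstDiff (a l) (a k)) ≠ c i := by
  set B : Finset (Fin N) :=
    Finset.univ.image fun p : Fin n × Fin n => a p.1 (PiNat.firstDiff (a p.2) (a p.1))
  have hcard : B.card ≤ n ^ 2 := by
    refine Finset.card_image_le.trans ?_
    simp [sq]
  have hcompl : Fintype.card (Fin n) ≤ Fintype.card {x // x ∈ Bᶜ} := by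
    rw [Fintype.card_coe, Finset.card_compl, Fintype.card_fin, Fintype.card_fin]
    omega
  obtain ⟨e⟩ := Function.Embedding.nonempty_of_card_le hcompl
  refine ⟨fun i => e i, fun i k h => e.injective (Subtype.ext h), fun i k l h => ?_⟩
  exact Finset.mem_compl.1 (e i).2 (Finset.mem_image.2 ⟨(k, l), Finset.mem_univ _, h⟩)

/-- Points of the gasket in at least `n ^ 2 + n` vertices, given by their addresses, lie in the
prescribed order on an arc in the gasket. -/
lemma exists_arc_through_addressPoints {n : ℕ} (hN : (n + 1) ^ 2 + (n + 1) ≤ N)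
    (a : Fin (n + 1) → ℕ → Fin N) (ha : Function.Injective fun i => addressPoint (a i)) :
    ∃ Γ : ℝ → Fin N → ℝ, Continuous Γ ∧ InjOn Γ (Icc 0 n) ∧
      (∀ i : Fin (n + 1), Γ i = addressPoint (a i)) ∧
      ∀ u ∈ Icc (0 : ℝ) n, Γ u ∈ range (addressPoint : (ℕ → Fin N) → Fin N → ℝ) := by
  obtain ⟨c, hc, hca⟩ := exists_directions hN a
  -- Extend the finite families to all natural numbers.
  set A : ℕ → ℕ → Fin N := fun i => a (Fin.ofNat (n + 1) i)
  set C : ℕ → Fin N := fun i => c (Fin.ofNat (n + 1) i)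
  have hof : ∀ i l, i ≤ n → l ≤ n → Fin.ofNat (n + 1) i = Fin.ofNat (n + 1) l → i = l := by
    intro i l hi hl h
    have := congrArg Fin.val h
    simp only [Fin.ofNat] at this
    rwa [Nat.mod_eq_of_lt (by omega), Nat.mod_eq_of_lt (by omega)] at this
  have hAinj : ∀ i l, i ≤ n → l ≤ n → addressPoint (A i) = addressPoint (A l) → i = l :=
    fun i l hi hl h => hof i l hi hl (ha h)
  have hex : ∀ i, ∃ γ : ℝ → Fin N → ℝ, i < n → Continuous γ ∧ InjOn γ (Icc 0 1) ∧
      γ 0 = addressPoint (A i) ∧ γ 1 = addressPoint (A (i + 1)) ∧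
      ∀ u ∈ Icc (0 : ℝ) 1, γ u ∈ raySet (C i) (A i) ∪ raySet (C i) (A (i + 1)) := by
    intro i
    by_cases hi : i < n
    · obtain ⟨γ, h⟩ := exists_arc_in_raySet (C i) (a := A i) (a' := A (i + 1)) fun h => by
        have := hAinj i (i + 1) hi.le hi h
        omega
      exact ⟨γ, fun _ => h⟩
    · exact ⟨fun _ => 0, fun h => absurd h hi⟩
  choose γ hγ using hex
  obtain ⟨Γ, hΓ, hΓi, hΓx, hΓγ⟩ := exists_arc_of_chain (fun i => addressPoint (A i)) γ n
    (fun i hi => (hγ i hi).1) (fun i hi => (hγ i hi).2.1) (fun i hi => (hγ i hi).2.2.1)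
    (fun i hi => (hγ i hi).2.2.2.1) (by
      intro i l hil hl s hs t ht heq
      have hmi := (hγ i (hil.trans hl)).2.2.2.2 s hs
      have hml := (hγ l hl).2.2.2.2 t ht
      rw [← heq] at hml
      have hCne : C i ≠ C l := fun h => hil.ne (hof i l (hil.trans hl).le hl.le (hc h))
      have key : ∀ p q, p ≤ n → q ≤ n → γ i s ∈ raySet (C i) (A p) →
          γ i s ∈ raySet (C l) (A q) → p = q ∧ γ i s = addressPoint (A q) := by
        intro p q hp hq h h'
        obtain ⟨e, e'⟩ := eq_of_mem_raySet_of_mem_raySet h h' hCne (fun _ => hca _ _ _)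
          (fun _ => hca _ _ _)
        exact ⟨hAinj p q hp hq (e.symm.trans e'), e'⟩
      rcases hmi with hmi | hmi <;> rcases hml with hml | hml
      · have := (key _ _ (by omega) (by omega) hmi hml).1
        omega
      · have := (key _ _ (by omega) (by omega) hmi hml).1
        omega
      · have := key _ _ (by omega) (by omega) hmi hml
        exact ⟨this.1.symm, this.2⟩
      · have := (key _ _ (by omega) (by omega) hmi hml).1
        omega)
  have hcast : ∀ i : Fin (n + 1), A i = a i := fun i => congrArg a (Fin.ofNat_val_eq_self i)
  refine ⟨Γ, hΓ, hΓi, fun i => ?_, fun u hu => ?_⟩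
  · rw [hΓx i (by omega)]
    rw [hcast]
  · rcases hΓγ u hu with rfl | ⟨i, hi, s, hs, h⟩
    · have := hΓx 0 (Nat.zero_le n)
      rw [Nat.cast_zero] at this
      exact ⟨_, this.symm⟩
    · rw [h]
      rcases (hγ i hi).2.2.2.2 s ⟨hs.1.le, hs.2⟩ with ⟨t, ht, e⟩ | ⟨t, ht, e⟩
      · exact e ▸ ray_mem_range _ _ ht
      · exact e ▸ ray_mem_range _ _ ht

/-! ### Addresses in the trix -/

section Module

variable {E : Type*} [AddCommGroup E] [Module ℝ E]

lemma simplices_succ' (v : Fin N → E) (m : ℕ) :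
    simplices v (m + 1) = ⋃ i, simplices (child v i) m := by
  induction m with
  | zero => ext S; simp [simplices, subdivide, eq_comm]
  | succ m ih =>
    rw [simplices, ih]
    ext S
    simp only [mem_iUnion, simplices, exists_prop]
    constructor
    · rintro ⟨T, ⟨i, hi⟩, hT⟩
      exact ⟨i, T, hi, hT⟩
    · rintro ⟨i, T, hi, hT⟩
      exact ⟨T, ⟨i, hi⟩, hT⟩

/-- Subdividing the corner simplices `m` times is the same as subdividing `m + 1` times. -/
lemma stage_succ' (v : Fin N → E) (m : ℕ) : stage v (m + 1) = ⋃ i, stage (child v i) m := by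
  unfold stage
  rw [simplices_succ', biUnion_iUnion]

lemma sum_smul_child (v : Fin N → E) (k : Fin N) {c : Fin N → ℝ} (hc : ∑ i, c i = 1) :
    ∑ i, c i • child v k i = ∑ i, (((if k = i then 1 else 0) + c i) / 2) • v i := by
  have h1 (i : Fin N) : c i • child v k i = (2⁻¹ : ℝ) • (c i • v k) + (c i / 2) • v i := by
    rw [child, midpoint_eq_smul_add, smul_smul, smul_add, smul_smul, invOf_eq_inv,
      mul_comm (c i), ← div_eq_inv_mul]
  have h2 (i : Fin N) : (((if k = i then 1 else 0) + c i) / 2) • v i =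
      (if k = i then (2⁻¹ : ℝ) • v i else 0) + (c i / 2) • v i := by
    split_ifs
    · rw [← add_smul]; congr 1; ring
    · simp
  simp only [h1, h2, Finset.sum_add_distrib, ← Finset.smul_sum, ← Finset.sum_smul, hc, one_smul]
  simp

/-- The first digit of an address chooses a corner simplex, and the other ones are an address
therein. -/
lemma sum_addressPoint_smul (v : Fin N → E) (a : ℕ → Fin N) :
    ∑ i, addressPoint a i • v i =
      ∑ i, addressPoint (fun m => a (m + 1)) i • child v (a 0) i := by
  rw [sum_smul_child v (a 0) (sum_addressPoint _)]
  exact Finset.sum_congr rfl fun i _ => by rw [addressPoint_succ]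

lemma sum_addressPoint_smul_mem_trix (v : Fin N → E) (a : ℕ → Fin N) :
    ∑ i, addressPoint a i • v i ∈ trix v := by
  refine mem_iInter.2 fun m => ?_
  induction m generalizing v a with
  | zero =>
    simp only [stage, simplices, mem_singleton_iff, iUnion_iUnion_eq_left]
    exact (convex_convexHull ℝ _).sum_mem (fun i _ => addressPoint_nonneg a i)
      (sum_addressPoint a) fun i _ => subset_convexHull ℝ _ (mem_range_self i)
  | succ m ih =>
    rw [stage_succ', sum_addressPoint_smul]
    exact mem_iUnion.2 ⟨a 0, ih _ _⟩

end Module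

lemma exists_addressPoint_near {E : Type*} [NormedAddCommGroup E] [NormedSpace ℝ E]
    (v : Fin N → E) {D : ℝ} (hD : ∀ i j, dist (v i) (v j) ≤ D) (m : ℕ) {y : E}
    (hy : y ∈ stage v m) :
    ∃ a : ℕ → Fin N, dist y (∑ i, addressPoint a i • v i) ≤ D * (1 / 2) ^ m := by
  induction m generalizing v D with
  | zero =>
    simp only [stage, simplices, mem_singleton_iff, iUnion_iUnion_eq_left] at hy
    obtain ⟨-, k, rfl⟩ := convexHull_nonempty_iff.1 ⟨y, hy⟩
    refine ⟨fun _ => k, ?_⟩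
    have h := (convex_convexHull ℝ (range v)).sum_mem
      (fun i _ => addressPoint_nonneg (fun _ => k) i) (sum_addressPoint _)
      fun i _ => subset_convexHull ℝ _ (mem_range_self i)
    obtain ⟨-, ⟨i, rfl⟩, -, ⟨j, rfl⟩, hij⟩ := convexHull_exists_dist_ge2 hy h
    rw [pow_zero, mul_one]
    exact hij.trans (hD i j)
  | succ m ih =>
    rw [stage_succ'] at hy
    obtain ⟨k, hk⟩ := mem_iUnion.1 hy
    have hD' : ∀ i j, dist (child v k i) (child v k j) ≤ D / 2 := by
      intro i j
      have := dist_midpoint_midpoint_le (v k) (v i) (v k) (v j)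
      rw [dist_self, zero_add] at this
      have := hD i j
      unfold child
      linarith
    obtain ⟨b, hb⟩ := ih (child v k) hD' hk
    refine ⟨fun m => Nat.casesOn m k b, ?_⟩
    rw [sum_addressPoint_smul]
    refine hb.trans (le_of_eq ?_)
    rw [pow_succ]; ring

/-- Every point of the trix has an address. -/
lemma exists_addressPoint_of_mem_trix {E : Type*} [NormedAddCommGroup E] [NormedSpace ℝ E]
    (v : Fin N → E) {y : E} (hy : y ∈ trix v) :
    ∃ a : ℕ → Fin N, ∑ i, addressPoint a i • v i = y := by
  have hΦ : Continuous fun a : ℕ → Fin N => ∑ i, addressPoint a i • v i :=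
    continuous_finsetSum _ fun i _ =>
      ((continuous_apply i).comp continuous_addressPoint).smul continuous_const
  suffices y ∈ range fun a : ℕ → Fin N => ∑ i, addressPoint a i • v i from this
  rw [← (isCompact_range hΦ).isClosed.closure_eq, Metric.mem_closure_iff]
  intro ε hε
  obtain ⟨D, hD⟩ := (finite_range fun p : Fin N × Fin N => dist (v p.1) (v p.2)).bddAbove
  have hD' : ∀ i j, dist (v i) (v j) ≤ D := fun i j => hD ⟨(i, j), rfl⟩
  have ht : Tendsto (fun m : ℕ => D * (1 / 2 : ℝ) ^ m) atTop (𝓝 (D * 0)) :=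
    (tendsto_pow_atTop_nhds_zero_of_lt_one (by norm_num) (by norm_num)).const_mul D
  rw [mul_zero] at ht
  obtain ⟨m, hm⟩ := (ht.eventually (gt_mem_nhds hε)).exists
  obtain ⟨a, ha⟩ := exists_addressPoint_near v hD' m (mem_iInter.1 hy m)
  exact ⟨_, mem_range_self a, ha.trans_lt hm⟩

/-- A trix with `N ≥ (n + 1) ^ 2 + (n + 1)` affinely independent vertices is `(n + 1)`-sac. -/
theorem isStronglyArcConnected_trix {E : Type*} [NormedAddCommGroup E] [NormedSpace ℝ E] {n : ℕ}
    (hn : 0 < n) (hN : (n + 1) ^ 2 + (n + 1) ≤ N) (v : Fin N → E) (hv : AffineIndependent ℝ v) :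
    IsStronglyArcConnected (n + 1) (trix v) := by
  intro x hx
  choose a ha using fun i => exists_addressPoint_of_mem_trix v (x i).2
  have hinj : Function.Injective fun i => addressPoint (a i) := by
    intro i k h
    dsimp only at h
    refine hx (Subtype.ext ?_)
    rw [← ha i, ← ha k, h]
  obtain ⟨Γ, hΓ, hΓi, hΓx, hΓm⟩ := exists_arc_through_addressPoints hN a hinj
  have hn' : (0 : ℝ) < n := Nat.cast_pos.2 hn
  have hI : ∀ u : unitInterval, (n : ℝ) * u ∈ Icc (0 : ℝ) n := fun u =>
    ⟨mul_nonneg hn'.le u.2.1, mul_le_of_le_one_right hn'.le u.2.2⟩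
  have hmem : ∀ u : unitInterval, ∑ i, Γ (n * u) i • v i ∈ trix v := by
    intro u
    obtain ⟨b, hb⟩ := hΓm _ (hI u)
    rw [← hb]
    exact sum_addressPoint_smul_mem_trix v b
  have hsum : ∀ u : unitInterval, ∑ i, Γ (n * u) i = 1 := by
    intro u
    obtain ⟨b, hb⟩ := hΓm _ (hI u)
    rw [← hb, sum_addressPoint]
  refine ⟨fun u => ⟨_, hmem u⟩, ?_, fun i => ⟨i / n, by positivity, ?_⟩, ?_, ?_⟩
  · refine (Continuous.isClosedEmbedding ?_ ?_).isEmbedding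
    · refine Continuous.subtype_mk (continuous_finsetSum _ fun i _ => ?_) _
      have : Continuous fun u : unitInterval => Γ (n * u) := by fun_prop
      exact ((continuous_apply i).comp this).smul continuous_const
    · intro s t hst
      have h := congrArg Subtype.val hst
      dsimp only at h
      have hΓst : Γ (n * s) = Γ (n * t) := by
        ext i
        exact (affineIndependent_iff_eq_of_fintype_affineCombination_eq ℝ v).1 hv _ _ (hsum s)
          (hsum t) (by
            rw [Finset.univ.affineCombination_eq_linear_combination _ _ (hsum s),
              Finset.univ.affineCombination_eq_linear_combination _ _ (hsum t), h]) ▸ rfl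
      exact Subtype.ext (mul_left_cancel₀ hn'.ne' (hΓi (hI s) (hI t) hΓst))
  · rw [div_le_one hn']
    exact_mod_cast Nat.lt_succ_iff.1 i.2
  · intro i k hik
    rw [← Subtype.coe_lt_coe]
    exact div_lt_div_of_pos_right (by exact_mod_cast hik) hn'
  · intro i
    refine Subtype.ext ?_
    dsimp only
    rw [mul_div_cancel₀ _ hn'.ne', hΓx, ha]

end NTrix

theorem mainTheorem5 (n : ℕ) (hn : 3 ≤ n)
    (v : Fin (6 * n ^ 2 + 12 * n + 1) → EuclideanSpace ℝ (Fin (6 * n ^ 2 + 12 * n)))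
    (hv : AffineIndependent ℝ v) :
    IsStronglyArcConnected n (NTrix.trix v) := by
  obtain ⟨m, rfl⟩ : ∃ m, n = m + 1 := ⟨n - 1, by omega⟩
  exact NTrix.isStronglyArcConnected_trix (by omega) (by nlinarith) v hv
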